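/- Let $N\ge 0$ be an integer and let $p_i,c_i,\xi_{i0}\in\mathbb{C}$ $(1\le i\le 2N)$ satisfy $p_i\neq 0$, $p_i+p_j\neq 0$ for all $i,j$, $c_i=-c_{2N+1-i}$ and $$p_i^2-p_ip_{2N+1-i}+p_{2N+1-i}^2=0\qquad(1\le i\le 2N).$$ Put $c_{i,j}=\delta_{j,2N+1-i}\,c_i$ and, for real variables $x_1,x_{-1}$, $\xi_i=p_ix_1+\frac1{p_i}x_{-1}+\xi_{i0}$. For $n\in\mathbb{Z}$ let $$\tau_n=\det\left(c_{i,j}+\frac{2p_i}{p_i+p_j}\left(-\frac{p_i}{p_j}\right)^{n-1}e^{\xi_i+\xi_j}\right)_{1\le i,j\le 2N}.$$ Then $f=\tau_1$ and $g=\tau_2$ are smooth functions of $(x_1,x_{-1})$ that satisfy the period-3 reduced bilinear equations $$-\left(\tfrac12D_{x_1}D_{x_{-1}}-1\right)f\cdot f=fg,\qquad -\left(\tfrac12D_{x_1}D_{x_{-1}}-1\right)g\cdot g=f^2,$$ where $D_{x_1}D_{x_{-1}}\,a\cdot b=(\partial_{x_1}-\partial_{x_1'})(\partial_{x_{-1}}-\partial_{x_{-1}'})\,a(x_1,x_{-1})\,b(x_1',x_{-1}')\big|_{x_1'=x_1,\;x_{-1}'=x_{-1}}$,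 and $f$ is the square of a pfaffian: $$f=\tau_1=\tau^2,\qquad \tau=\mathrm{pf}(1,2,\dots,2N),\qquad \mathrm{pf}(i,j)=c_{i,j}+\frac{p_i-p_j}{p_i+p_j}\,e^{\xi_i+\xi_j}.$$ Here, for a skew-symmetric matrix with entries $a_{i,j}=\mathrm{pf}(i,j)$, $\mathrm{pf}(1,\dots,2N)=\sum_\pi \mathrm{sgn}(\pi)\,a_{i_1,j_1}\cdots a_{i_N,j_N}$, the sum being over the permutations $\pi=\begin{pmatrix}1&2&\cdots&2N-1&2N\\ i_1&j_1&\cdots&i_N&j_N\end{pmatrix}$ of $\{1,\dots,2N\}$ with $i_1<\cdots<i_N$ and $i_k<j_k$ for all $k$. -/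

import Mathlib

open scoped BigOperators

noncomputable section

namespace TodaPfaffian

/-- The position `2k - 1` of `{1, …, 2N}` (the index `2k` when counting from zero). -/
def oddPos {N : ℕ} (k : Fin N) : Fin (2 * N) := ⟨2 * k.val, by omega⟩

/-- The position `2k` of `{1, …, 2N}` (the index `2k + 1` when counting from zero). -/
def evenPos {N : ℕ} (k : Fin N) : Fin (2 * N) := ⟨2 * k.val + 1, by omega⟩

/-- The permutations `π = (1 2 ⋯ 2N-1 2N ; i₁ j₁ ⋯ i_N j_N)` with
`i₁ < i₂ < ⋯ < i_N` and `i₁ < j₁, …, i_N < j_N`. -/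
def pairings (N : ℕ) : Finset (Equiv.Perm (Fin (2 * N))) :=
  Finset.univ.filter fun π =>
    (∀ k l : Fin N, k < l → π (oddPos k) < π (oddPos l)) ∧
      ∀ k : Fin N, π (oddPos k) < π (evenPos k)

/-- The pfaffian `∑ sgn(π) a_{i₁,j₁} a_{i₂,j₂} ⋯ a_{i_N,j_N}` over the permutations `pairings N`. -/
def pfaffian {R : Type*} [CommRing R] {N : ℕ} (A : Matrix (Fin (2 * N)) (Fin (2 * N)) R) : R :=
  ∑ π ∈ pairings N, ((Equiv.Perm.sign π : ℤ) : R) * ∏ k : Fin N, A (π (oddPos k)) (π (evenPos k))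

/-- `∂_{x₁} - ∂_{x₁'}` acting on functions of `(x₁, x₋₁, x₁', x₋₁')`. -/
def diffX (F : ℝ → ℝ → ℝ → ℝ → ℂ) : ℝ → ℝ → ℝ → ℝ → ℂ := fun x y x' y' =>
  deriv (fun s => F s y x' y') x - deriv (fun s => F x y s y') x'

/-- `∂_{x₋₁} - ∂_{x₋₁'}` acting on functions of `(x₁, x₋₁, x₁', x₋₁')`. -/
def diffY (F : ℝ → ℝ → ℝ → ℝ → ℂ) : ℝ → ℝ → ℝ → ℝ → ℂ := fun x y x' y' =>
  deriv (fun s => F x s x' y') y - deriv (fun s => F x y x' s) y'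

/-- The Hirota bilinear operator `D_{x₁} D_{x₋₁} a · b`: the operator
`(∂_{x₁} - ∂_{x₁'}) (∂_{x₋₁} - ∂_{x₋₁'})` applied to `a(x₁, x₋₁) b(x₁', x₋₁')`,
evaluated at `x₁' = x₁`, `x₋₁' = x₋₁`. -/
def hirotaDD (a b : ℝ → ℝ → ℂ) (x y : ℝ) : ℂ :=
  diffX (diffY fun s t s' t' => a s t * b s' t') x y x y

/-- The smooth functions `f, g` of `(x₁, x₋₁)` satisfy the bilinear equations
`-(½ D_{x₁} D_{x₋₁} - 1) f · f = f g` and `-(½ D_{x₁} D_{x₋₁} - 1) g · g = f²`. -/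
structure SolvesBilinear (f g : ℝ → ℝ → ℂ) : Prop where
  smooth_fst : ContDiff ℝ (⊤ : ℕ∞) (fun z : ℝ × ℝ => f z.1 z.2)
  smooth_snd : ContDiff ℝ (⊤ : ℕ∞) (fun z : ℝ × ℝ => g z.1 z.2)
  eq_fst : ∀ x y : ℝ, -((1 / 2) * hirotaDD f f x y - f x y * f x y) = f x y * g x y
  eq_snd : ∀ x y : ℝ, -((1 / 2) * hirotaDD g g x y - g x y * g x y) = f x y ^ 2

/-- The phase `ξ_i = p_i x₁ + x₋₁ / p_i + ξ_{i0}`. -/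
def phase {N : ℕ} (p ξ₀ : Fin (2 * N) → ℂ) (x y : ℝ) (i : Fin (2 * N)) : ℂ :=
  p i * x + 1 / p i * y + ξ₀ i

/-- The constants `c_{i,j} = δ_{j, 2N+1-i} c_i`; the index `2N+1-i` is `Fin.rev i`. -/
def antidiag {N : ℕ} (c : Fin (2 * N) → ℂ) (i j : Fin (2 * N)) : ℂ :=
  if j = Fin.rev i then c i else 0

/-- The Gram-type determinant `τ_n = det (ψ_{i,j}^{(n)})` of size `2N`, where
`ψ_{i,j}^{(n)} = c_{i,j} + 2 p_i / (p_i + p_j) * (-p_i / p_j)^(n-1) * exp (ξ_i + ξ_j)`. -/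
def gramTau {N : ℕ} (p c ξ₀ : Fin (2 * N) → ℂ) (n : ℤ) (x y : ℝ) : ℂ :=
  (Matrix.of fun i j : Fin (2 * N) =>
    antidiag c i j + 2 * p i / (p i + p j) * (-(p i / p j)) ^ (n - 1) *
      Complex.exp (phase p ξ₀ x y i + phase p ξ₀ x y j)).det

/-- The pfaffian `τ = pf(1, 2, …, 2N)` with entries
`pf(i,j) = c_{i,j} + (p_i - p_j) / (p_i + p_j) * exp (ξ_i + ξ_j)`. -/
def pfTau {N : ℕ} (p c ξ₀ : Fin (2 * N) → ℂ) (x y : ℝ) : ℂ :=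
  pfaffian (Matrix.of fun i j : Fin (2 * N) =>
    antidiag c i j + (p i - p j) / (p i + p j) *
      Complex.exp (phase p ξ₀ x y i + phase p ξ₀ x y j))

end TodaPfaffian

end

/-! For every `n` the Gram determinants satisfy the bilinear Toda equation, with right-hand side
`τ_{n+1} τ_{n-1}` (`hirotaDD_gramTau`). Both first derivatives of the Gram matrix have rank one, and
so do its changes under `n ↦ n ± 1`; with Jacobi's formula and the matrix determinant lemma, both
sides become the same polynomial in bilinear forms of the adjugate (`hirotaDD_det`).

Two symmetries close the chain: skewness of `c_{i,j}` gives `τ_{1-n} = τ_n`, and the quadratic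
relation on the `p_i` gives `τ_{n+3} = τ_n`. Hence `τ_0 = τ_1 = τ_3`, and the cases `n = 1, 2` are
the two equations.

For the pfaffian, `2p_i/(p_i+p_j) = 1 + (p_i-p_j)/(p_i+p_j)` writes the Gram matrix at `n = 1` as a
skew matrix plus `e eᵀ`. In even size this rank-one term does not affect the determinant, so
Cayley's theorem (`det_eq_pfaffian_sq`) applies. That theorem is proved by congruence to `2 × 2`
blocks, where the pfaffian is covariant because it is a multiple of a sum over all permutations. -/

section

open Matrix

/-! ### Rank-one updates and derivatives of determinants -/

/-- The **matrix determinant lemma**, without an invertibility hypothesis. -/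
theorem Matrix.det_add_vecMulVec_complex {ι : Type*} [Fintype ι] [DecidableEq ι]
    (A : Matrix ι ι ℂ) (u v : ι → ℂ) :
    (A + vecMulVec u v).det = A.det + v ⬝ᵥ (A.adjugate *ᵥ u) := by
  have key : ∀ B : Matrix ι ι ℂ, B.det ≠ 0 →
      (B + vecMulVec u v).det = B.det + v ⬝ᵥ (B.adjugate *ᵥ u) := by
    intro B hB
    rw [vecMulVec_eq Unit, det_add_replicateCol_mul_replicateRow (isUnit_iff_ne_zero.2 hB),
      det_unique (n := Unit), Matrix.mul_assoc, Matrix.add_apply, Matrix.one_apply_eq, inv_def]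
    have : (replicateRow Unit v * (Ring.inverse B.det • B.adjugate * replicateCol Unit u))
        default default = B.det⁻¹ * (v ⬝ᵥ (B.adjugate *ᵥ u)) := by
      rw [Ring.inverse_eq_inv', Matrix.smul_mul, Matrix.mul_smul, Matrix.smul_apply, smul_eq_mul]
      rfl
    rw [this]
    field_simp
  -- The invertible case extends by continuity: `A + t` is singular only at the finitely many roots
  -- of the characteristic polynomial of `-A`.
  have hd : Dense {t : ℂ | (A + t • (1 : Matrix ι ι ℂ)).det ≠ 0} := by
    have hfin : {t : ℂ | (-A).charpoly.IsRoot t}.Finite :=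
      Polynomial.finite_setOfPred_isRoot (charpoly_monic _).ne_zero
    convert hfin.countable.dense_compl ℝ using 1
    ext t
    simp [Polynomial.IsRoot, Matrix.eval_charpoly, add_comm, Matrix.smul_one_eq_diagonal]
  have hA : Continuous fun t : ℂ => A + t • (1 : Matrix ι ι ℂ) := by fun_prop
  have h1 : Continuous fun t : ℂ => (A + t • (1 : Matrix ι ι ℂ) + vecMulVec u v).det :=
    (hA.add continuous_const).matrix_det
  have h2 : Continuous fun t : ℂ => (A + t • (1 : Matrix ι ι ℂ)).det +
      v ⬝ᵥ ((A + t • (1 : Matrix ι ι ℂ)).adjugate *ᵥ u) :=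
    hA.matrix_det.add
      (continuous_const.dotProduct (hA.matrix_adjugate.matrix_mulVec continuous_const))
  have := congrFun (h1.ext_on hd h2 fun t ht => key _ ht) 0
  simpa using this

/-- **Jacobi's formula** for the derivative of a determinant. -/
theorem Matrix.hasDerivAt_det {ι : Type*} [Fintype ι] [DecidableEq ι]
    {M : ℝ → Matrix ι ι ℂ} {M' : Matrix ι ι ℂ} {t : ℝ}
    (h : ∀ i j, HasDerivAt (fun s => M s i j) (M' i j) t) :
    HasDerivAt (fun s => (M s).det) ((M t).adjugate * M').trace t := by
  simp only [det_apply']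
  have hd := HasDerivAt.fun_sum (u := Finset.univ) fun (σ : Equiv.Perm ι) _ =>
    (HasDerivAt.fun_finsetProd (u := Finset.univ) fun i _ => h (σ i) i).const_mul
      (((Equiv.Perm.sign σ : ℤ) : ℂ))
  refine hd.congr_deriv (Eq.symm ?_)
  have hc : ∀ i, ((M t).adjugate * M') i i = ((M t).updateCol i fun j => M' j i).det := by
    intro i
    rw [← cramer_apply, cramer_eq_adjugate_mulVec]
    rfl
  simp only [trace, diag_apply, hc, det_apply', Finset.mul_sum]
  rw [Finset.sum_comm]
  refine Finset.sum_congr rfl fun σ _ => Finset.sum_congr rfl fun i _ => ?_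
  rw [← Finset.prod_erase_mul _ _ (Finset.mem_univ i), smul_eq_mul, updateCol_self]
  congr 2
  refine Finset.prod_congr rfl fun j hj => ?_
  rw [updateCol_ne (Finset.ne_of_mem_erase hj)]

/-- The derivative of the adjugate of a matrix, up to multiplication by the determinant. -/
theorem Matrix.exists_hasDerivAt_adjugate {ι : Type*} [Fintype ι] [DecidableEq ι]
    {M : ℝ → Matrix ι ι ℂ} {M' : Matrix ι ι ℂ} {t : ℝ}
    (h : ∀ i j, HasDerivAt (fun s => M s i j) (M' i j) t) :
    ∃ D : Matrix ι ι ℂ, (∀ i j, HasDerivAt (fun s => (M s).adjugate i j) (D i j) t) ∧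
      (M t).det • D = ((M t).adjugate * M').trace • (M t).adjugate -
        (M t).adjugate * M' * (M t).adjugate := by
  have hex : ∀ i j, ∃ d, HasDerivAt (fun s => (M s).adjugate i j) d t := by
    intro i j
    simp only [adjugate_apply]
    -- An adjugate entry is the determinant after row `j` is replaced by a constant row, so that row
    -- of the derivative is zero.
    refine ⟨_, hasDerivAt_det
      (M' := of fun k l => if k = j then 0 else M' k l) fun k l => ?_⟩
    by_cases hk : k = j
    · subst hk
      simpa using hasDerivAt_const t _
    · simpa [updateRow_ne hk, hk] using h k l
  choose D hD using hex
  refine ⟨of D, hD, ?_⟩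
  -- Differentiating `adj M * M = det M • 1` and multiplying by `adj M` on the right avoids any
  -- division by `det M`.
  have hmul : of D * M t + (M t).adjugate * M' =
      ((M t).adjugate * M').trace • (1 : Matrix ι ι ℂ) := by
    ext i j
    have h1 : HasDerivAt (fun s => ((M s).adjugate * M s) i j)
        ((of D * M t + (M t).adjugate * M') i j) t := by
      simp only [mul_apply, Matrix.add_apply, ← Finset.sum_add_distrib]
      exact HasDerivAt.fun_sum fun k _ => (hD i k).mul (h k j)
    have h2 : HasDerivAt (fun s => ((M s).adjugate * M s) i j)
        ((((M t).adjugate * M').trace • (1 : Matrix ι ι ℂ)) i j) t := by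
      simp only [adjugate_mul, Matrix.smul_apply, smul_eq_mul]
      exact (hasDerivAt_det h).mul_const _
    exact h1.unique h2
  have := congrArg (· * (M t).adjugate) hmul
  simp only [Matrix.add_mul, Matrix.mul_assoc, mul_adjugate, Matrix.mul_smul, Matrix.mul_one,
    Matrix.smul_mul, Matrix.one_mul] at this
  rw [← this, Matrix.mul_assoc]
  abel

namespace TodaPfaffian

/-! ### The bilinear Toda equation for determinants -/

theorem hirotaDD_self {a ax ay axy : ℝ → ℝ → ℂ}
    (hx : ∀ x y, HasDerivAt (fun s => a s y) (ax x y) x)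
    (hy : ∀ x y, HasDerivAt (fun s => a x s) (ay x y) y)
    (hxy : ∀ x y, HasDerivAt (fun s => ay s y) (axy x y) x) (x y : ℝ) :
    hirotaDD a a x y = 2 * (a x y * axy x y - ax x y * ay x y) := by
  have h1 : (diffY fun s t s' t' => a s t * a s' t') =
      fun x y x' y' => ay x y * a x' y' - a x y * ay x' y' := by
    funext x y x' y'
    simp only [diffY]
    rw [((hy x y).mul_const _).deriv, ((hy x' y').const_mul _).deriv]
  rw [hirotaDD, h1]
  simp only [diffX]
  rw [(((hxy x y).mul_const _).fun_sub ((hx x y).mul_const _)).deriv,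
    (((hx x y).const_mul _).fun_sub ((hxy x y).const_mul _)).deriv]
  ring

/-- The bilinear Toda lattice equation for a Gram-type determinant whose first derivatives have
rank one. -/
theorem hirotaDD_det {ι : Type*} [Fintype ι] [DecidableEq ι] {M : ℝ → ℝ → Matrix ι ι ℂ}
    {u v a b : ℝ → ℝ → ι → ℂ}
    (hx : ∀ x y i j, HasDerivAt (fun s => M s y i j) (2 * a x y i * v x y j) x)
    (hy : ∀ x y i j, HasDerivAt (fun s => M x s i j) (2 * u x y i * b x y j) y)
    (hu : ∀ x y i, HasDerivAt (fun s => u s y i) (a x y i) x)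
    (hb : ∀ x y i, HasDerivAt (fun s => b s y i) (v x y i) x) (x y : ℝ) :
    -((1 / 2) * hirotaDD (fun x y => (M x y).det) (fun x y => (M x y).det) x y -
        (M x y).det * (M x y).det) =
      (M x y + vecMulVec ((-2 : ℂ) • a x y) (b x y)).det *
        (M x y + vecMulVec ((-2 : ℂ) • u x y) (v x y)).det := by
  have htr : ∀ (A : Matrix ι ι ℂ) (r s : ι → ℂ),
      (A * of fun i j => 2 * r i * s j).trace = 2 * (s ⬝ᵥ (A *ᵥ r)) := by
    intro A r s
    simp only [trace, diag_apply, mul_apply, of_apply, dotProduct, mulVec, Finset.mul_sum]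
    exact Finset.sum_congr rfl fun i _ => Finset.sum_congr rfl fun j _ => by ring
  have hdx : ∀ x y, HasDerivAt (fun s => (M s y).det)
      (2 * (v x y ⬝ᵥ ((M x y).adjugate *ᵥ a x y))) x := fun x y => by
    rw [← htr]
    exact hasDerivAt_det (hx x y)
  have hdy : ∀ x y, HasDerivAt (fun s => (M x s).det)
      (2 * (b x y ⬝ᵥ ((M x y).adjugate *ᵥ u x y))) y := fun x y => by
    rw [← htr]
    exact hasDerivAt_det (hy x y)
  choose D hD hD' using fun x y => exists_hasDerivAt_adjugate
    (M' := of fun i j => 2 * a x y i * v x y j) (hx x y)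
  have hdxy : ∀ x y, HasDerivAt (fun s => 2 * (b s y ⬝ᵥ ((M s y).adjugate *ᵥ u s y)))
      (2 * (v x y ⬝ᵥ ((M x y).adjugate *ᵥ u x y) + b x y ⬝ᵥ (D x y *ᵥ u x y) +
        b x y ⬝ᵥ ((M x y).adjugate *ᵥ a x y))) x := fun x y => by
    refine HasDerivAt.const_mul _ ?_
    simp only [dotProduct, mulVec]
    rw [← Finset.sum_add_distrib, ← Finset.sum_add_distrib]
    refine HasDerivAt.fun_sum fun i _ => ?_
    refine ((hb x y i).fun_mul (HasDerivAt.fun_sum (u := Finset.univ) fun j _ =>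
      (hD x y i j).fun_mul (hu x y j))).congr_deriv ?_
    simp only [Finset.sum_add_distrib]
    ring
  rw [hirotaDD_self hdx hdy hdxy, det_add_vecMulVec_complex, det_add_vecMulVec_complex]
  simp only [mulVec_smul, dotProduct_smul, smul_eq_mul]
  have hE := congrArg (fun E => b x y ⬝ᵥ (E *ᵥ u x y)) (hD' x y)
  -- Rank one of the `x`-derivative factors this term into a product of scalars, matching the cross
  -- term on the right-hand side.
  have hrank : ((M x y).adjugate * (of fun i j => 2 * a x y i * v x y j) * (M x y).adjugate) *ᵥ u x y
      = (2 * (v x y ⬝ᵥ ((M x y).adjugate *ᵥ u x y))) • ((M x y).adjugate *ᵥ a x y) := by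
    have : (of fun i j => 2 * a x y i * v x y j) = (2 : ℂ) • vecMulVec (a x y) (v x y) := by
      ext i j
      simp [vecMulVec_apply, mul_assoc]
    rw [this, ← mulVec_mulVec, ← mulVec_mulVec, smul_mulVec, mulVec_smul, vecMulVec_mulVec]
    simp [mulVec_smul, smul_smul]
  simp only [sub_mulVec, dotProduct_sub, hrank, htr, smul_mulVec, dotProduct_smul,
    smul_eq_mul] at hE
  linear_combination (-2) * hE

/-! ### Pfaffians as sums over all permutations -/

/-- The positions `1, …, 2N` arranged in two rows, the odd ones and the even ones. -/
def posEquiv (N : ℕ) : Fin 2 × Fin N ≃ Fin (2 * N) where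
  toFun x := ⟨2 * x.2.val + x.1.val, by omega⟩
  invFun j := (⟨j.val % 2, by omega⟩, ⟨j.val / 2, by omega⟩)
  left_inv x := by
    ext <;> simp <;> omega
  right_inv j := by
    ext
    simp
    omega

theorem posEquiv_zero {N : ℕ} (k : Fin N) : posEquiv N (0, k) = oddPos k := rfl

theorem posEquiv_one {N : ℕ} (k : Fin N) : posEquiv N (1, k) = evenPos k := rfl

theorem forall_pos {N : ℕ} {P : Fin (2 * N) → Prop} :
    (∀ j, P j) ↔ (∀ k, P (oddPos k)) ∧ ∀ k, P (evenPos k) := by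
  rw [← (posEquiv N).forall_congr_right, Prod.forall, Fin.forall_fin_two]
  rfl

theorem prod_pos {R : Type*} [CommMonoid R] {N : ℕ} (g : Fin (2 * N) → R) :
    ∏ j, g j = ∏ k : Fin N, g (oddPos k) * g (evenPos k) := by
  rw [← (posEquiv N).prod_comp, Fintype.prod_prod_type_right]
  simp only [Fin.prod_univ_two, posEquiv_zero, posEquiv_one]

/-- The permutation of `Fin 2 × Fin N` that permutes the columns by `ρ` and the entries of the
`k`-th column by `s k`. -/
def columnPerm {N : ℕ} (x : Equiv.Perm (Fin N) × (Fin N → Equiv.Perm (Fin 2))) :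
    Equiv.Perm (Fin 2 × Fin N) :=
  Equiv.prodCongrRight (fun _ => x.1) * Equiv.prodCongrLeft x.2

theorem columnPerm_apply {N : ℕ} (x : Equiv.Perm (Fin N) × (Fin N → Equiv.Perm (Fin 2)))
    (i : Fin 2) (k : Fin N) : columnPerm x (i, k) = (x.2 k i, x.1 k) := rfl

/-- Permuting columns acts identically on the two rows, so its sign occurs squared and only the
flips inside columns count. -/
theorem sign_columnPerm {N : ℕ} (x : Equiv.Perm (Fin N) × (Fin N → Equiv.Perm (Fin 2))) :
    Equiv.Perm.sign (columnPerm x) = ∏ k, Equiv.Perm.sign (x.2 k) := by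
  rw [columnPerm, Equiv.Perm.sign_mul, Equiv.Perm.sign_prodCongrRight,
    Equiv.Perm.sign_prodCongrLeft, Fin.prod_univ_two, Int.units_mul_self, one_mul]

/-- The signed product attached to a permutation in the expansion of the pfaffian. -/
def pfaffianTerm {R : Type*} [CommRing R] {N : ℕ} (A : Matrix (Fin (2 * N)) (Fin (2 * N)) R)
    (σ : Equiv.Perm (Fin (2 * N))) : R :=
  ((Equiv.Perm.sign σ : ℤ) : R) * ∏ k : Fin N, A (σ (oddPos k)) (σ (evenPos k))

theorem permCongr_posEquiv_apply {N : ℕ} (h : Equiv.Perm (Fin 2 × Fin N)) (x : Fin 2 × Fin N) :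
    (posEquiv N).permCongr h (posEquiv N x) = posEquiv N (h x) := by
  simp [Equiv.permCongr_apply]

theorem eq_one_or_eq_swap (s : Equiv.Perm (Fin 2)) : s = 1 ∨ s = Equiv.swap 0 1 := by
  revert s
  decide

/-- Each flip inside a column changes both the sign of the permutation and, by skewness, one matrix
entry; reordering columns only reorders the product. -/
theorem pfaffianTerm_mul_columnPerm {R : Type*} [CommRing R] {N : ℕ}
    {A : Matrix (Fin (2 * N)) (Fin (2 * N)) R} (hA : Aᵀ = -A) (σ : Equiv.Perm (Fin (2 * N)))
    (x : Equiv.Perm (Fin N) × (Fin N → Equiv.Perm (Fin 2))) :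
    pfaffianTerm A (σ * (posEquiv N).permCongr (columnPerm x)) = pfaffianTerm A σ := by
  have hent : ∀ i j, A i j = -A j i := fun i j => by
    simpa using congrFun (congrFun hA j) i
  have hcol : ∀ k, A (σ (posEquiv N (x.2 k 0, x.1 k))) (σ (posEquiv N (x.2 k 1, x.1 k))) =
      ((Equiv.Perm.sign (x.2 k) : ℤ) : R) * A (σ (oddPos (x.1 k))) (σ (evenPos (x.1 k))) := by
    intro k
    rcases eq_one_or_eq_swap (x.2 k) with h | h
    · simp [h, posEquiv_zero, posEquiv_one]
    · simpa [h, posEquiv_zero, posEquiv_one] using hent _ _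
  simp only [pfaffianTerm, Equiv.Perm.mul_apply, ← posEquiv_zero, ← posEquiv_one,
    permCongr_posEquiv_apply, columnPerm_apply, Equiv.Perm.sign_mul, Equiv.Perm.sign_permCongr,
    sign_columnPerm]
  simp only [posEquiv_zero, posEquiv_one, hcol, Finset.prod_mul_distrib, Units.val_mul,
    Units.coe_prod, Int.cast_mul, Int.cast_prod]
  rw [Equiv.prod_comp x.1 fun k => A (σ (oddPos k)) (σ (evenPos k))]
  have hsq : (∏ k, ((Equiv.Perm.sign (x.2 k) : ℤ) : R)) *
      ∏ k, ((Equiv.Perm.sign (x.2 k) : ℤ) : R) = 1 := by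
    rw [← Finset.prod_mul_distrib]
    refine Finset.prod_eq_one fun k _ => ?_
    rw [← Int.cast_mul, ← Units.val_mul, Int.units_mul_self, Units.val_one, Int.cast_one]
  linear_combination (((Equiv.Perm.sign σ : ℤ) : R) *
    ∏ k, A (σ (oddPos k)) (σ (evenPos k))) * hsq

theorem mem_pairings {N : ℕ} {π : Equiv.Perm (Fin (2 * N))} :
    π ∈ pairings N ↔ StrictMono (fun k => π (oddPos k)) ∧ ∀ k, π (oddPos k) < π (evenPos k) := by
  simp [pairings, StrictMono]

/-- With `exists_mul_columnPerm`, this makes `pairings N` a system of representatives for the cosets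
of the column permutations. -/
theorem mul_columnPerm_injOn (N : ℕ) :
    Set.InjOn (fun y : Equiv.Perm (Fin (2 * N)) ×
        (Equiv.Perm (Fin N) × (Fin N → Equiv.Perm (Fin 2))) =>
      y.1 * (posEquiv N).permCongr (columnPerm y.2)) {y | y.1 ∈ pairings N} := by
  rintro ⟨π, ρ, s⟩ hπ ⟨π', ρ', s'⟩ hπ' h
  simp only [Set.mem_ofPred_eq, mem_pairings] at hπ hπ'
  have hval : ∀ i k, π (posEquiv N (s k i, ρ k)) = π' (posEquiv N (s' k i, ρ' k)) := fun i k => by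
    simpa [permCongr_posEquiv_apply, columnPerm_apply] using
      Equiv.congr_fun h (posEquiv N (i, k))
  have hcol : ∀ k, s k = s' k ∧ π (oddPos (ρ k)) = π' (oddPos (ρ' k)) ∧
      π (evenPos (ρ k)) = π' (evenPos (ρ' k)) := by
    intro k
    have h0 := hval 0 k
    have h1 := hval 1 k
    have l := hπ.2 (ρ k)
    have l' := hπ'.2 (ρ' k)
    rcases eq_one_or_eq_swap (s k) with e | e <;> rcases eq_one_or_eq_swap (s' k) with e' | e' <;>
      simp only [e, e', Equiv.Perm.one_apply, Equiv.swap_apply_left, Equiv.swap_apply_right,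
        posEquiv_zero, posEquiv_one] at h0 h1 ⊢
    · exact ⟨trivial, h0, h1⟩
    · rw [h0, h1] at l
      exact absurd l l'.asymm
    · rw [h0, h1] at l
      exact absurd l l'.asymm
    · exact ⟨trivial, h1, h0⟩
  -- Strictly increasing sequences with the same range coincide, and reindexing by `ρ` or `ρ'`
  -- leaves the range unchanged.
  have hodd : (fun k => π (oddPos k)) = fun k => π' (oddPos k) := by
    rw [← hπ.1.range_inj hπ'.1, ← ρ.surjective.range_comp (fun k => π (oddPos k)),
      ← ρ'.surjective.range_comp (fun k => π' (oddPos k))]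
    exact congrArg Set.range (funext fun k => (hcol k).2.1)
  have hρ : ρ = ρ' := by
    ext1 k
    exact hπ.1.injective ((hcol k).2.1.trans (congrFun hodd (ρ' k)).symm)
  subst hρ
  have hs : s = s' := funext fun k => (hcol k).1
  subst hs
  simpa using h

/-- Sort each column of `σ`, then sort the columns by their minima; undoing both sorts is a column
permutation. -/
theorem exists_mul_columnPerm {N : ℕ} (σ : Equiv.Perm (Fin (2 * N))) :
    ∃ π ∈ pairings N, ∃ x, π * (posEquiv N).permCongr (columnPerm x) = σ := by
  set m : Fin N → Fin (2 * N) := fun k => min (σ (oddPos k)) (σ (evenPos k)) with hm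
  set t : Fin N → Equiv.Perm (Fin 2) :=
    fun k => if σ (oddPos k) < σ (evenPos k) then 1 else Equiv.swap 0 1 with ht
  have h0 : ∀ k, σ (posEquiv N (t k 0, k)) = m k := by
    intro k
    by_cases h : σ (oddPos k) < σ (evenPos k)
    · simp [hm, ht, h, h.le, posEquiv_zero]
    · simp [hm, ht, h, not_lt.1 h, posEquiv_one]
  have h1 : ∀ k, σ (posEquiv N (t k 1, k)) = max (σ (oddPos k)) (σ (evenPos k)) := by
    intro k
    by_cases h : σ (oddPos k) < σ (evenPos k)
    · simp [ht, h, h.le, posEquiv_one]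
    · simp [ht, h, not_lt.1 h, posEquiv_zero]
  have hinj : Function.Injective m := by
    intro k l hkl
    rw [← h0, ← h0] at hkl
    exact congrArg Prod.snd ((posEquiv N).injective (σ.injective hkl))
  have hτ : StrictMono (m ∘ Tuple.sort m) :=
    (Tuple.monotone_sort m).strictMono_of_injective (hinj.comp (Tuple.sort m).injective)
  set τ := Tuple.sort m
  have hval : ∀ i k, (σ * (posEquiv N).permCongr (columnPerm (τ, t ∘ τ))) (posEquiv N (i, k)) =
      σ (posEquiv N (t (τ k) i, τ k)) := fun i k => by
    simp [columnPerm_apply]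
  refine ⟨σ * (posEquiv N).permCongr (columnPerm (τ, t ∘ τ)), ?_, (τ⁻¹, t⁻¹), ?_⟩
  · rw [mem_pairings]
    simp only [← posEquiv_zero, ← posEquiv_one, hval, h0, h1]
    refine ⟨hτ, fun k => min_lt_max.2 fun h => ?_⟩
    simpa [oddPos, evenPos] using σ.injective h
  · ext1 j
    obtain ⟨⟨i, k⟩, rfl⟩ := (posEquiv N).surjective j
    rw [Equiv.Perm.mul_apply, permCongr_posEquiv_apply, columnPerm_apply, hval]
    simp

/-- The pfaffian of a skew-symmetric matrix as a sum over all permutations. -/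
theorem sum_pfaffianTerm {R : Type*} [CommRing R] {N : ℕ}
    {A : Matrix (Fin (2 * N)) (Fin (2 * N)) R} (hA : Aᵀ = -A) :
    ∑ σ, pfaffianTerm A σ =
      Fintype.card (Equiv.Perm (Fin N) × (Fin N → Equiv.Perm (Fin 2))) * pfaffian A := by
  have : ∑ y ∈ pairings N ×ˢ (Finset.univ :
      Finset (Equiv.Perm (Fin N) × (Fin N → Equiv.Perm (Fin 2)))), pfaffianTerm A y.1 =
      ∑ σ, pfaffianTerm A σ := by
    refine Finset.sum_nbij (fun y => y.1 * (posEquiv N).permCongr (columnPerm y.2))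
      (fun _ _ => Finset.mem_univ _) ?_ ?_ fun y _ => (pfaffianTerm_mul_columnPerm hA _ _).symm
    · refine (mul_columnPerm_injOn N).mono fun y hy => ?_
      simpa using hy
    · intro σ _
      obtain ⟨π, hπ, x, h⟩ := exists_mul_columnPerm σ
      exact ⟨(π, x), by simpa using hπ, h⟩
  rw [← this, Finset.sum_product, pfaffian, Finset.mul_sum]
  refine Finset.sum_congr rfl fun π _ => ?_
  refine (Finset.sum_const (pfaffianTerm A π)).trans ?_
  rw [nsmul_eq_mul, Finset.card_univ, pfaffianTerm]

/-- Expanding and exchanging sums leaves, for each index map `f`, the determinant of `B` with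
columns chosen by `f`. It vanishes unless `f` is a permutation, when it is `sign f * det B`. -/
theorem sum_pfaffianTerm_congr {R : Type*} [CommRing R] {N : ℕ}
    (A B : Matrix (Fin (2 * N)) (Fin (2 * N)) R) :
    ∑ σ, pfaffianTerm (B * A * Bᵀ) σ = B.det * ∑ σ, pfaffianTerm A σ := by
  have hterm : ∀ σ, pfaffianTerm (B * A * Bᵀ) σ = ∑ f : Fin (2 * N) → Fin (2 * N),
      (∏ k, A (f (oddPos k)) (f (evenPos k))) *
        (((Equiv.Perm.sign σ : ℤ) : R) * ∏ j, B (σ j) (f j)) := by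
    intro σ
    let e : (Fin (2 * N) → Fin (2 * N)) ≃ (Fin N → Fin (2 * N) × Fin (2 * N)) :=
      { toFun := fun f k => (f (oddPos k), f (evenPos k))
        invFun := fun q j =>
          if ((posEquiv N).symm j).1 = 0 then (q ((posEquiv N).symm j).2).1
          else (q ((posEquiv N).symm j).2).2
        left_inv := fun f => by
          rw [funext_iff, forall_pos]
          simp [← posEquiv_zero, ← posEquiv_one]
        right_inv := fun q => by
          ext1 k
          simp [← posEquiv_zero, ← posEquiv_one] }
    have hent : ∀ i j, (B * A * Bᵀ) i j =
        ∑ q : Fin (2 * N) × Fin (2 * N), B i q.1 * A q.1 q.2 * B j q.2 := by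
      intro i j
      simp only [mul_apply, transpose_apply, Finset.sum_mul, Fintype.sum_prod_type]
      exact Finset.sum_comm
    simp only [pfaffianTerm, hent]
    rw [Finset.prod_univ_sum, Fintype.piFinset_univ, Finset.mul_sum, ← e.sum_comp]
    refine Finset.sum_congr rfl fun f _ => ?_
    rw [prod_pos, mul_left_comm, ← Finset.prod_mul_distrib]
    congr 1
    exact Finset.prod_congr rfl fun k _ => by
      simp only [e, Equiv.coe_fn_mk]
      ring
  have hdet : ∀ f : Fin (2 * N) → Fin (2 * N),
      ∑ σ : Equiv.Perm (Fin (2 * N)), ((Equiv.Perm.sign σ : ℤ) : R) * ∏ j, B (σ j) (f j) =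
        (B.submatrix id f).det := fun f => by
    rw [det_apply']
    rfl
  simp only [hterm]
  rw [Finset.sum_comm]
  simp only [← Finset.mul_sum, hdet]
  rw [Finset.mul_sum]
  symm
  refine Finset.sum_of_injOn (fun τ : Equiv.Perm (Fin (2 * N)) => ⇑τ)
    DFunLike.coe_injective.injOn (fun _ _ => by simp) (fun f _ hf => ?_) fun τ _ => ?_
  · have hninj : ¬ Function.Injective f := fun hinj =>
      hf ⟨Equiv.ofBijective f (Finite.injective_iff_bijective.1 hinj), by simp, rfl⟩
    simp only [Function.Injective, not_forall] at hninj
    obtain ⟨i, j, hij, hne⟩ := hninj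
    rw [det_zero_of_column_eq hne fun k => by simp [hij], mul_zero]
  · rw [det_permute', pfaffianTerm]
    ring

/-- The pfaffian of a direct sum of `2 × 2` blocks. -/
theorem pfaffian_of_blocks {R : Type*} [CommRing R] {N : ℕ}
    {S : Matrix (Fin (2 * N)) (Fin (2 * N)) R} (a : Fin N → R)
    (hdiag : ∀ k, S (oddPos k) (evenPos k) = a k)
    (hoff : ∀ i j k l, k ≠ l → S (posEquiv N (i, k)) (posEquiv N (j, l)) = 0) :
    pfaffian S = ∏ k, a k := by
  rw [pfaffian, Finset.sum_eq_single 1]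
  · simp [hdiag]
  · intro π hπ hne
    rw [mem_pairings] at hπ
    by_contra hprod
    have hblock : ∀ k, ∃ l, π (oddPos k) = oddPos l ∧ π (evenPos k) = evenPos l := by
      intro k
      have hk : S (π (oddPos k)) (π (evenPos k)) ≠ 0 := fun h0 =>
        hprod (by rw [Finset.prod_eq_zero (Finset.mem_univ k) h0, mul_zero])
      obtain ⟨⟨i, l⟩, hi⟩ := (posEquiv N).surjective (π (oddPos k))
      obtain ⟨⟨j, l'⟩, hj⟩ := (posEquiv N).surjective (π (evenPos k))
      have hll : l = l' := by
        by_contra h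
        exact hk (by rw [← hi, ← hj, hoff _ _ _ _ h])
      subst hll
      have hlt := hπ.2 k
      rw [← hi, ← hj, Fin.lt_def] at hlt
      simp only [posEquiv, Equiv.coe_fn_mk] at hlt
      have hi0 : i = 0 := by omega
      have hj1 : j = 1 := by omega
      exact ⟨l, by rw [← hi, hi0, posEquiv_zero], by rw [← hj, hj1, posEquiv_one]⟩
    choose m hm0 hm1 using hblock
    have hmono : StrictMono m := by
      intro k l hkl
      have : π (oddPos k) < π (oddPos l) := hπ.1 hkl
      rw [hm0, hm0, Fin.lt_def] at this
      simp only [oddPos] at this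
      rw [Fin.lt_def]
      omega
    have hid : m = id := by
      rw [← hmono.range_inj strictMono_id, Set.range_id, Set.range_eq_univ]
      exact Finite.surjective_of_injective hmono.injective
    subst hid
    refine hne (Equiv.ext ?_)
    rw [forall_pos]
    exact ⟨hm0, hm1⟩
  · intro h
    refine absurd (mem_pairings.2 ⟨fun k l hkl => ?_, fun k => ?_⟩) h
    · simp only [Equiv.Perm.one_apply, oddPos, Fin.lt_def] at hkl ⊢
      omega
    · simp [oddPos, evenPos, Fin.lt_def]

/-- The determinant of a direct sum of skew-symmetric `2 × 2` blocks. -/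
theorem det_of_blocks {R : Type*} [CommRing R] {N : ℕ}
    {S : Matrix (Fin (2 * N)) (Fin (2 * N)) R} (a : Fin N → R)
    (hS : S.submatrix (posEquiv N) (posEquiv N) =
      blockDiagonal fun k => a k • (!![0, 1; -1, 0] : Matrix (Fin 2) (Fin 2) R)) :
    S.det = (∏ k, a k) ^ 2 := by
  rw [← det_submatrix_equiv_self (posEquiv N), hS, det_blockDiagonal, ← Finset.prod_pow]
  refine Finset.prod_congr rfl fun k _ => ?_
  simp [det_fin_two, sq]

/-! ### Normal form of alternating forms and Cayley's theorem -/

/-- An alternating form on a space of even dimension is a direct sum of planes. -/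
theorem exists_basis_isAlt {K : Type*} [Field K] (N : ℕ) :
    ∀ {V : Type*} [AddCommGroup V] [Module K V] [FiniteDimensional K V]
      (_ : Module.finrank K V = 2 * N) (ω : LinearMap.BilinForm K V) (_ : ω.IsAlt),
      ∃ (b : Module.Basis (Fin 2 × Fin N) K V) (a : Fin N → K), ∀ x y, ω (b x) (b y) =
        blockDiagonal (fun k => a k • (!![0, 1; -1, 0] : Matrix (Fin 2) (Fin 2) K)) x y := by
  induction N with
  | zero =>
    intro V _ _ _ hV ω _
    exact ⟨(Module.finBasisOfFinrankEq K V hV).reindex (posEquiv 0).symm, 0,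
      fun x => x.2.elim0⟩
  | succ N ih =>
    intro V _ _ _ hV ω hω
    by_cases h0 : ω = 0
    · refine ⟨(Module.finBasisOfFinrankEq K V hV).reindex (posEquiv (N + 1)).symm, 0,
        fun x y => ?_⟩
      simp [h0, blockDiagonal_apply]
    obtain ⟨u, v, huv⟩ : ∃ u v, ω u v = 1 := by
      obtain ⟨u, v, h⟩ : ∃ u v, ω u v ≠ 0 := by
        by_contra! h
        exact h0 (LinearMap.ext₂ h)
      exact ⟨u, (ω u v)⁻¹ • v, by simp [h]⟩
    have hvu : ω v u = -1 := by rw [← hω.neg_eq, huv]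
    -- The kernel of `F` is the orthogonal complement of the hyperbolic plane spanned by `u, v`;
    -- surjectivity of `F` gives it dimension `2N`.
    let F : V →ₗ[K] K × K := (ω u).prod (ω v)
    have hF : ∀ w, F w = (ω u w, ω v w) := fun w => rfl
    have hsurj : LinearMap.range F = ⊤ := by
      rw [LinearMap.range_eq_top]
      rintro ⟨r, s⟩
      refine ⟨r • v - s • u, ?_⟩
      simp [hF, huv, hvu, hω.self_eq_zero]
    have hker : Module.finrank K (LinearMap.ker F) = 2 * N := by
      have := F.finrank_range_add_finrank_ker
      rw [hsurj, finrank_top, Module.finrank_prod, Module.finrank_self, hV] at this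
      omega
    obtain ⟨b, a, hb⟩ := ih hker (ω.restrict (LinearMap.ker F)) fun w => hω w
    have hkerb : ∀ x, ω u (b x) = 0 ∧ ω v (b x) = 0 := fun x => by
      have := (b x).2
      rwa [LinearMap.mem_ker, hF, Prod.mk_eq_zero] at this
    have hkerb' : ∀ x, ω (b x) u = 0 ∧ ω (b x) v = 0 := fun x =>
      ⟨by rw [← hω.neg_eq, (hkerb x).1, neg_zero], by rw [← hω.neg_eq, (hkerb x).2, neg_zero]⟩
    let c : Fin 2 × Fin (N + 1) → V := fun x =>
      Fin.cases (![u, v] x.1) (fun k => (b (x.1, k) : V)) x.2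
    have hc0 : c (0, 0) = u := rfl
    have hc1 : c (1, 0) = v := rfl
    have hcs : ∀ i k, c (i, Fin.succ k) = b (i, k) := fun i k => rfl
    have hli : LinearIndependent K c := by
      rw [Fintype.linearIndependent_iff]
      intro g hg
      have hsum : g (0, 0) • u + g (1, 0) • v + ∑ x : Fin 2 × Fin N, g (x.1, x.2.succ) • (b x : V)
          = 0 := by
        rw [← hg]
        simp only [Fintype.sum_prod_type, Fin.sum_univ_two, Fin.sum_univ_succ (n := N), hc0, hc1, hcs]
        abel
      have h1 : g (1, 0) = 0 := by
        have := congrArg (ω u) hsum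
        simpa [huv, hω.self_eq_zero, hkerb] using this
      have h2 : g (0, 0) = 0 := by
        have := congrArg (ω v) hsum
        simpa [hvu, hω.self_eq_zero, hkerb] using this
      have h3 : ∑ x : Fin 2 × Fin N, g (x.1, x.2.succ) • b x = 0 := by
        refine Subtype.ext ?_
        simpa [h1, h2] using hsum
      have h4 := Fintype.linearIndependent_iff.1 b.linearIndependent _ h3
      rintro ⟨i, k⟩
      refine Fin.cases ?_ (fun k => h4 (i, k)) k
      fin_cases i
      exacts [h2, h1]
    have hcard : Fintype.card (Fin 2 × Fin (N + 1)) = Module.finrank K V := by simp [hV]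
    refine ⟨basisOfLinearIndependentOfCardEqFinrank hli hcard, Fin.cons 1 a, ?_⟩
    rw [coe_basisOfLinearIndependentOfCardEqFinrank]
    rintro ⟨i, k⟩ ⟨j, l⟩
    rw [blockDiagonal_apply]
    refine Fin.cases ?_ (fun k => ?_) k <;> refine Fin.cases ?_ (fun l => ?_) l
    · fin_cases i <;> fin_cases j <;> simp [hc0, hc1, huv, hvu, hω.self_eq_zero]
    · rw [hcs, if_neg (Fin.succ_ne_zero l).symm]
      fin_cases i
      exacts [(hkerb _).1, (hkerb _).2]
    · rw [hcs, if_neg (Fin.succ_ne_zero k)]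
      fin_cases j
      exacts [(hkerb' _).1, (hkerb' _).2]
    · have := hb (i, k) (j, l)
      rw [blockDiagonal_apply] at this
      simpa [hcs, Fin.succ_inj] using this

/-- **Cayley's theorem**: the determinant of a skew-symmetric matrix of even size is the square of
its pfaffian. -/
theorem det_eq_pfaffian_sq {K : Type*} [Field K] [CharZero K] {N : ℕ}
    {A : Matrix (Fin (2 * N)) (Fin (2 * N)) K} (hA : Aᵀ = -A) : A.det = pfaffian A ^ 2 := by
  have halt : (Matrix.toBilin' A).IsAlt := by
    intro w
    have h : w ⬝ᵥ (A *ᵥ w) = -(w ⬝ᵥ (A *ᵥ w)) := by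
      conv_lhs => rw [dotProduct_mulVec, ← mulVec_transpose, hA, neg_mulVec, neg_dotProduct,
        dotProduct_comm]
    rw [Matrix.toBilin'_apply']
    exact self_eq_neg.1 h
  obtain ⟨b, a, hb⟩ := exists_basis_isAlt N (by simp) (Matrix.toBilin' A) halt
  set B : Matrix (Fin (2 * N)) (Fin (2 * N)) K := of fun j => b ((posEquiv N).symm j) with hB
  have hdet : B.det ≠ 0 := by
    rw [← isUnit_iff_ne_zero, ← isUnit_iff_isUnit_det, ← linearIndependent_rows_iff_isUnit]
    exact b.linearIndependent.comp _ (posEquiv N).symm.injective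
  have hS : (B * A * Bᵀ).submatrix (posEquiv N) (posEquiv N) =
      blockDiagonal fun k => a k • (!![0, 1; -1, 0] : Matrix (Fin 2) (Fin 2) K) := by
    ext x y
    rw [← hb, Matrix.toBilin'_apply', submatrix_apply, Matrix.mul_assoc, mul_apply']
    simp only [hB, of_apply, Equiv.symm_apply_apply, dotProduct, mul_apply, mulVec,
      transpose_apply]
  have hS' : ∀ x y, (B * A * Bᵀ) (posEquiv N x) (posEquiv N y) = blockDiagonal
      (fun k => a k • (!![0, 1; -1, 0] : Matrix (Fin 2) (Fin 2) K)) x y := fun x y => by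
    rw [← hS, submatrix_apply]
  have hskew : (B * A * Bᵀ)ᵀ = -(B * A * Bᵀ) := by
    simp [transpose_mul, hA, Matrix.mul_assoc]
  -- The nonzero cardinality factor cancels in characteristic zero.
  have hpf : pfaffian (B * A * Bᵀ) = B.det * pfaffian A := by
    have h := sum_pfaffianTerm_congr A B
    rw [sum_pfaffianTerm hA, sum_pfaffianTerm hskew, mul_left_comm] at h
    exact mul_left_cancel₀ (Nat.cast_ne_zero.2 Fintype.card_ne_zero) h
  have hpfS : pfaffian (B * A * Bᵀ) = ∏ k, a k := by
    refine pfaffian_of_blocks a (fun k => ?_) fun i j k l hkl => ?_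
    · rw [← posEquiv_zero, ← posEquiv_one, hS', blockDiagonal_apply_eq]
      simp
    · rw [hS', blockDiagonal_apply_ne _ _ _ hkl]
  have hdetS := det_of_blocks a hS
  rw [← hpfS, hpf, det_mul, det_mul, det_transpose] at hdetS
  refine mul_left_cancel₀ (pow_ne_zero 2 hdet) ?_
  linear_combination hdetS

/-! ### The Gram matrix and its shifts -/

/-- The matrix whose determinant is `gramTau`. -/
noncomputable def gramMatrix {N : ℕ} (p c ξ₀ : Fin (2 * N) → ℂ) (n : ℤ) (x y : ℝ) :
    Matrix (Fin (2 * N)) (Fin (2 * N)) ℂ :=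
  Matrix.of fun i j : Fin (2 * N) =>
    antidiag c i j + 2 * p i / (p i + p j) * (-(p i / p j)) ^ (n - 1) *
      Complex.exp (phase p ξ₀ x y i + phase p ξ₀ x y j)

/-- The left factors of the entries of the Gram matrix. -/
noncomputable def leftWave {N : ℕ} (p ξ₀ : Fin (2 * N) → ℂ) (n : ℤ) (x y : ℝ) (i : Fin (2 * N)) : ℂ :=
  (-p i) ^ (n - 1) * Complex.exp (phase p ξ₀ x y i)

/-- The right factors of the entries of the Gram matrix. -/
noncomputable def rightWave {N : ℕ} (p ξ₀ : Fin (2 * N) → ℂ) (n : ℤ) (x y : ℝ) (j : Fin (2 * N)) : ℂ :=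
  (p j ^ (n - 1))⁻¹ * Complex.exp (phase p ξ₀ x y j)

variable {N : ℕ} {p c : Fin (2 * N) → ℂ}

theorem gramMatrix_apply (ξ₀ : Fin (2 * N) → ℂ) (n : ℤ) (x y : ℝ) (i j : Fin (2 * N)) :
    gramMatrix p c ξ₀ n x y i j = antidiag c i j +
      2 * p i / (p i + p j) * (leftWave p ξ₀ n x y i * rightWave p ξ₀ n x y j) := by
  rw [gramMatrix, of_apply, ← neg_div, div_zpow, Complex.exp_add, leftWave, rightWave]
  ring

theorem hasDerivAt_phase_fst (ξ₀ : Fin (2 * N) → ℂ) (x y : ℝ) (i : Fin (2 * N)) :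
    HasDerivAt (fun s : ℝ => phase p ξ₀ s y i) (p i) x := by
  simpa [phase] using
    (Complex.ofRealCLM.hasDerivAt (x := x)).const_mul (p i)

theorem hasDerivAt_phase_snd (ξ₀ : Fin (2 * N) → ℂ) (x y : ℝ) (i : Fin (2 * N)) :
    HasDerivAt (fun s : ℝ => phase p ξ₀ x s i) (p i)⁻¹ y := by
  simpa [phase] using
    (Complex.ofRealCLM.hasDerivAt (x := y)).const_mul (p i)⁻¹

theorem hasDerivAt_leftWave_fst (ξ₀ : Fin (2 * N) → ℂ) (n : ℤ) (x y : ℝ) (i : Fin (2 * N)) :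
    HasDerivAt (fun s => leftWave p ξ₀ n s y i) (p i * leftWave p ξ₀ n x y i) x :=
  ((hasDerivAt_phase_fst ξ₀ x y i).cexp.const_mul _).congr_deriv (by rw [leftWave]; ring)

theorem hasDerivAt_leftWave_snd (ξ₀ : Fin (2 * N) → ℂ) (n : ℤ) (x y : ℝ) (i : Fin (2 * N)) :
    HasDerivAt (fun s => leftWave p ξ₀ n x s i) ((p i)⁻¹ * leftWave p ξ₀ n x y i) y :=
  ((hasDerivAt_phase_snd ξ₀ x y i).cexp.const_mul _).congr_deriv (by rw [leftWave]; ring)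

theorem hasDerivAt_rightWave_fst (ξ₀ : Fin (2 * N) → ℂ) (n : ℤ) (x y : ℝ) (i : Fin (2 * N)) :
    HasDerivAt (fun s => rightWave p ξ₀ n s y i) (p i * rightWave p ξ₀ n x y i) x :=
  ((hasDerivAt_phase_fst ξ₀ x y i).cexp.const_mul _).congr_deriv (by rw [rightWave]; ring)

theorem hasDerivAt_rightWave_snd (ξ₀ : Fin (2 * N) → ℂ) (n : ℤ) (x y : ℝ) (i : Fin (2 * N)) :
    HasDerivAt (fun s => rightWave p ξ₀ n x s i) ((p i)⁻¹ * rightWave p ξ₀ n x y i) y :=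
  ((hasDerivAt_phase_snd ξ₀ x y i).cexp.const_mul _).congr_deriv (by rw [rightWave]; ring)

/-- The shift multiplies the wave product by `-p_i/p_j`; the difference carries a factor `p_i +
p_j`, which cancels the denominator and leaves rank one. -/
theorem gramMatrix_add_one (hp : ∀ i, p i ≠ 0) (hpp : ∀ i j, p i + p j ≠ 0)
    (ξ₀ : Fin (2 * N) → ℂ) (n : ℤ) (x y : ℝ) :
    gramMatrix p c ξ₀ n x y + vecMulVec ((-2 : ℂ) • fun i => p i * leftWave p ξ₀ n x y i)
      (fun j => (p j)⁻¹ * rightWave p ξ₀ n x y j) = gramMatrix p c ξ₀ (n + 1) x y := by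
  ext i j
  have hi := hp i
  have hj := hp j
  have hij := hpp i j
  have hl : leftWave p ξ₀ (n + 1) x y i = -p i * leftWave p ξ₀ n x y i := by
    rw [leftWave, leftWave, add_sub_right_comm, zpow_add_one₀ (neg_ne_zero.2 hi)]
    ring
  have hr : rightWave p ξ₀ (n + 1) x y j = (p j)⁻¹ * rightWave p ξ₀ n x y j := by
    rw [rightWave, rightWave, add_sub_right_comm, zpow_add_one₀ hj, mul_inv]
    ring
  rw [Matrix.add_apply, vecMulVec_apply, Pi.smul_apply, smul_eq_mul, gramMatrix_apply,
    gramMatrix_apply, hl, hr]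
  field_simp
  ring

theorem gramMatrix_sub_one (hp : ∀ i, p i ≠ 0) (hpp : ∀ i j, p i + p j ≠ 0)
    (ξ₀ : Fin (2 * N) → ℂ) (n : ℤ) (x y : ℝ) :
    gramMatrix p c ξ₀ n x y + vecMulVec ((-2 : ℂ) • leftWave p ξ₀ n x y)
      (rightWave p ξ₀ n x y) = gramMatrix p c ξ₀ (n - 1) x y := by
  ext i j
  have hi := hp i
  have hj := hp j
  have hij := hpp i j
  have hl : leftWave p ξ₀ (n - 1) x y i = -(p i)⁻¹ * leftWave p ξ₀ n x y i := by
    rw [leftWave, leftWave, zpow_sub_one₀ (neg_ne_zero.2 hi) (n - 1), inv_neg]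
    ring
  have hr : rightWave p ξ₀ (n - 1) x y j = p j * rightWave p ξ₀ n x y j := by
    rw [rightWave, rightWave, zpow_sub_one₀ hj (n - 1), mul_inv, inv_inv]
    ring
  rw [Matrix.add_apply, vecMulVec_apply, Pi.smul_apply, smul_eq_mul, gramMatrix_apply,
    gramMatrix_apply, hl, hr]
  field_simp
  ring

/-- The bilinear two-dimensional Toda lattice equation. -/
theorem hirotaDD_gramTau (hp : ∀ i, p i ≠ 0) (hpp : ∀ i j, p i + p j ≠ 0)
    (ξ₀ : Fin (2 * N) → ℂ) (n : ℤ) (x y : ℝ) :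
    -((1 / 2) * hirotaDD (gramTau p c ξ₀ n) (gramTau p c ξ₀ n) x y -
        gramTau p c ξ₀ n x y * gramTau p c ξ₀ n x y) =
      gramTau p c ξ₀ (n + 1) x y * gramTau p c ξ₀ (n - 1) x y := by
  refine (hirotaDD_det (M := gramMatrix p c ξ₀ n) (u := leftWave p ξ₀ n)
    (v := rightWave p ξ₀ n) (a := fun x y i => p i * leftWave p ξ₀ n x y i)
    (b := fun x y j => (p j)⁻¹ * rightWave p ξ₀ n x y j) ?_ ?_ ?_ ?_ x y).trans ?_
  · intro x y i j
    have hij := hpp i j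
    simp only [gramMatrix_apply]
    refine ((((hasDerivAt_leftWave_fst ξ₀ n x y i).mul
      (hasDerivAt_rightWave_fst ξ₀ n x y j)).const_mul _).const_add _).congr_deriv ?_
    field_simp
  · intro x y i j
    have hi := hp i
    have hj := hp j
    have hij := hpp i j
    simp only [gramMatrix_apply]
    refine ((((hasDerivAt_leftWave_snd ξ₀ n x y i).mul
      (hasDerivAt_rightWave_snd ξ₀ n x y j)).const_mul _).const_add _).congr_deriv ?_
    field_simp
    ring
  · exact hasDerivAt_leftWave_fst ξ₀ n
  · intro x y j
    refine ((hasDerivAt_rightWave_fst ξ₀ n x y j).const_mul _).congr_deriv ?_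
    rw [inv_mul_cancel_left₀ (hp j)]
  · rw [gramMatrix_add_one hp hpp, gramMatrix_sub_one hp hpp]
    rfl

theorem contDiff_gramTau (p c ξ₀ : Fin (2 * N) → ℂ) (n : ℤ) :
    ContDiff ℝ (⊤ : ℕ∞) (fun z : ℝ × ℝ => gramTau p c ξ₀ n z.1 z.2) := by
  have hphase : ∀ i, ContDiff ℝ (⊤ : ℕ∞) (fun z : ℝ × ℝ => phase p ξ₀ z.1 z.2 i) := fun i =>
    ((contDiff_const.mul (Complex.ofRealCLM.contDiff.comp contDiff_fst)).add
      (contDiff_const.mul (Complex.ofRealCLM.contDiff.comp contDiff_snd))).add contDiff_const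
  simp only [gramTau, det_apply', of_apply]
  refine ContDiff.sum fun σ _ => contDiff_const.mul (contDiff_prod fun i _ => ?_)
  exact contDiff_const.add (contDiff_const.mul ((hphase _).add (hphase _)).cexp)

/-! ### Reflection and period three -/

theorem antidiag_swap (hc : ∀ i, c i = -c (Fin.rev i)) (i j : Fin (2 * N)) :
    antidiag c j i = -antidiag c i j := by
  by_cases h : j = Fin.rev i
  · subst h
    simp [antidiag, hc i]
  · have h' : i ≠ Fin.rev j := fun e => h (by rw [e, Fin.rev_rev])
    simp [antidiag, h, h']

theorem det_neg_of_even (A : Matrix (Fin (2 * N)) (Fin (2 * N)) ℂ) : (-A).det = A.det := by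
  rw [det_neg, Fintype.card_fin, pow_mul, neg_one_sq, one_pow, one_mul]

/-- Reflection `n ↦ 1 - n` is negative transposition of the Gram matrix, which is invisible to the
determinant in even size. -/
theorem gramTau_one_sub (hp : ∀ i, p i ≠ 0) (hc : ∀ i, c i = -c (Fin.rev i))
    (ξ₀ : Fin (2 * N) → ℂ) (n : ℤ) (x y : ℝ) :
    gramTau p c ξ₀ (1 - n) x y = gramTau p c ξ₀ n x y := by
  have : gramMatrix p c ξ₀ (1 - n) x y = -(gramMatrix p c ξ₀ n x y)ᵀ := by
    ext i j
    have hi := hp i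
    have hj := hp j
    have hpow : (-(p i / p j)) ^ (1 - n - 1) = -(p j / p i) * (-(p j / p i)) ^ (n - 1) := by
      have h0 : -(p j / p i) ≠ 0 := neg_ne_zero.2 (div_ne_zero hj hi)
      rw [show 1 - n - 1 = -n by ring, _root_.zpow_neg, ← _root_.inv_zpow, inv_neg, inv_div,
        ← zpow_one_add₀ h0, add_sub_cancel]
    simp only [gramMatrix, of_apply, Matrix.neg_apply, transpose_apply]
    rw [hpow, antidiag_swap hc i j, add_comm (p j), add_comm (phase p ξ₀ x y j)]
    field_simp
    ring
  change (gramMatrix p c ξ₀ (1 - n) x y).det = (gramMatrix p c ξ₀ n x y).det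
  rw [this, det_neg_of_even, det_transpose]

/-- The shift by three is, up to sign, conjugation by `diag(p_i³)`. The constants are compatible
because `p_i³ = -p_j³` on the antidiagonal. -/
theorem gramTau_add_three (hp : ∀ i, p i ≠ 0)
    (hred : ∀ i, p i ^ 2 - p i * p (Fin.rev i) + p (Fin.rev i) ^ 2 = 0)
    (ξ₀ : Fin (2 * N) → ℂ) (n : ℤ) (x y : ℝ) :
    gramTau p c ξ₀ (n + 3) x y = gramTau p c ξ₀ n x y := by
  have : gramMatrix p c ξ₀ (n + 3) x y = -(diagonal (fun i => p i ^ 3) *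
      gramMatrix p c ξ₀ n x y * diagonal fun j => (p j ^ 3)⁻¹) := by
    ext i j
    have hi := hp i
    have hj := hp j
    have hpow : (-(p i / p j)) ^ (n + 3 - 1) = -(p i ^ 3 / p j ^ 3) * (-(p i / p j)) ^ (n - 1) := by
      have h0 : -(p i / p j) ≠ 0 := neg_ne_zero.2 (div_ne_zero hi hj)
      rw [show n + 3 - 1 = (n - 1) + 3 by ring, zpow_add₀ h0, show ((3 : ℤ)) = ((3 : ℕ) : ℤ) from rfl,
        zpow_natCast, Odd.neg_pow (by decide), div_pow]
      ring
    have hanti : antidiag c i j = -(p i ^ 3 * antidiag c i j * (p j ^ 3)⁻¹) := by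
      by_cases h : j = Fin.rev i
      · subst h
        have hcube : p i ^ 3 = -p (Fin.rev i) ^ 3 := by
          -- The relation is the quadratic factor of a sum of two cubes.
          linear_combination (p i + p (Fin.rev i)) * hred i
        rw [hcube]
        field_simp
      · simp [antidiag, h]
    rw [Matrix.neg_apply, mul_diagonal, diagonal_mul]
    simp only [gramMatrix, of_apply]
    rw [hpow, mul_add, add_mul, neg_add, ← hanti]
    ring
  change (gramMatrix p c ξ₀ (n + 3) x y).det = (gramMatrix p c ξ₀ n x y).det
  rw [this, det_neg_of_even, det_mul, det_mul, det_diagonal, det_diagonal, mul_right_comm,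
    ← Finset.prod_mul_distrib, Finset.prod_eq_one fun i _ => mul_inv_cancel₀ (pow_ne_zero 3 (hp i)),
    one_mul]

/-! ### The pfaffian square -/

/-- Adding a symmetric matrix of rank one to a skew-symmetric matrix of even size does not change
its determinant. -/
theorem det_add_vecMulVec_self {A : Matrix (Fin (2 * N)) (Fin (2 * N)) ℂ} (hA : Aᵀ = -A)
    (e : Fin (2 * N) → ℂ) : (A + vecMulVec e e).det = A.det := by
  have h1 := det_add_vecMulVec_complex A e e
  have h2 := det_add_vecMulVec_complex A (-e) e
  -- Negative transposition exchanges `A - e eᵀ` and `A + e eᵀ`, while the determinant lemma is odd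
  -- in the correction term, which must therefore vanish.
  have h3 : (A + vecMulVec (-e) e).det = (A + vecMulVec e e).det := by
    rw [← det_transpose (A + vecMulVec e e), ← det_neg_of_even, transpose_add, hA,
      transpose_vecMulVec, neg_add, neg_vecMulVec, neg_neg]
  rw [mulVec_neg, dotProduct_neg] at h2
  linear_combination (1 / 2) * (h1 + h2 - h3)

theorem gramTau_one_eq_pfTau_sq (hpp : ∀ i j, p i + p j ≠ 0) (hc : ∀ i, c i = -c (Fin.rev i))
    (ξ₀ : Fin (2 * N) → ℂ) (x y : ℝ) : gramTau p c ξ₀ 1 x y = pfTau p c ξ₀ x y ^ 2 := by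
  set A : Matrix (Fin (2 * N)) (Fin (2 * N)) ℂ := Matrix.of fun i j : Fin (2 * N) =>
    antidiag c i j + (p i - p j) / (p i + p j) *
      Complex.exp (phase p ξ₀ x y i + phase p ξ₀ x y j) with hAdef
  have hA : Aᵀ = -A := by
    ext i j
    simp only [hAdef, transpose_apply, Matrix.neg_apply, of_apply]
    rw [antidiag_swap hc i j, add_comm (p j), add_comm (phase p ξ₀ x y j), ← neg_sub (p i)]
    ring
  have hM : gramMatrix p c ξ₀ 1 x y = A + vecMulVec (fun i => Complex.exp (phase p ξ₀ x y i))
      fun i => Complex.exp (phase p ξ₀ x y i) := by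
    ext i j
    have hij := hpp i j
    rw [Matrix.add_apply, vecMulVec_apply, ← Complex.exp_add]
    simp only [gramMatrix, hAdef, of_apply, sub_self, zpow_zero]
    field_simp
    ring
  change (gramMatrix p c ξ₀ 1 x y).det = pfaffian A ^ 2
  rw [hM, det_add_vecMulVec_self hA, det_eq_pfaffian_sq hA]

end TodaPfaffian

end

theorem mainTheorem4 (N : ℕ) (p c ξ₀ : Fin (2 * N) → ℂ)
    (hp : ∀ i, p i ≠ 0)
    (hpp : ∀ i j, p i + p j ≠ 0)
    (hc : ∀ i, c i = -c (Fin.rev i))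
    (hred : ∀ i, p i ^ 2 - p i * p (Fin.rev i) + p (Fin.rev i) ^ 2 = 0) :
    TodaPfaffian.SolvesBilinear
        (TodaPfaffian.gramTau p c ξ₀ 1) (TodaPfaffian.gramTau p c ξ₀ 2) ∧
      ∀ x y : ℝ,
        TodaPfaffian.gramTau p c ξ₀ 1 x y = TodaPfaffian.pfTau p c ξ₀ x y ^ 2 := by
  have h0 : ∀ x y, TodaPfaffian.gramTau p c ξ₀ 0 x y = TodaPfaffian.gramTau p c ξ₀ 1 x y :=
    fun x y => by simpa using TodaPfaffian.gramTau_one_sub hp hc ξ₀ 1 x y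
  have h3 : ∀ x y, TodaPfaffian.gramTau p c ξ₀ 3 x y = TodaPfaffian.gramTau p c ξ₀ 1 x y :=
    fun x y => by
      simpa [h0] using TodaPfaffian.gramTau_add_three (c := c) hp hred ξ₀ 0 x y
  refine ⟨⟨TodaPfaffian.contDiff_gramTau p c ξ₀ 1, TodaPfaffian.contDiff_gramTau p c ξ₀ 2,
    fun x y => ?_, fun x y => ?_⟩, TodaPfaffian.gramTau_one_eq_pfTau_sq hpp hc ξ₀⟩
  · have h := TodaPfaffian.hirotaDD_gramTau (c := c) hp hpp ξ₀ 1 x y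
    norm_num at h
    rw [h0] at h
    norm_num
    rw [h, mul_comm]
  · have h := TodaPfaffian.hirotaDD_gramTau (c := c) hp hpp ξ₀ 2 x y
    norm_num at h
    rw [h3] at h
    norm_num
    rw [h, sq]
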